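/- Let $d,r,q,k,\Delta\ge 0$ be integers with $d<r$, $r=q(d+1)+k$ and $0\le k\le d$ (so $q=\lfloor r/(d+1)\rfloor\ge 1$). Let $G$ be a finite $r$-partite graph with parts $V_1,\dots,V_r$ (so the $V_i$ partition the vertex set and every edge joins two different parts), with maximum degree at most $\Delta$, such that for every $i$ \[|V_i|>\max\left\{2\Delta\left(1-\frac{4d+5}{4r}\right),\ 2\Delta\left(1-\frac1q\right)\right\}.\] Then $G$ has an independent $(r-d)$-transversal, that is, an independent set of $r-d$ vertices lying in $r-d$ different parts. In other words, let $n(r,D,\Delta)$ be the largest integer $n\ge 0$ for which there is a finite $r$-partite graph with at least $n$ vertices in each part, maximum degree exactly $\Delta$, and no independent $(r-D+1)$-transversal (and $n(r,D,\Delta)=0$ if there is no such $n$). Then the set of $n$ with this property for $D=d+1$ is bounded above, and \[n(r,d+1,\Delta)\le\max\left\{2\Delta\left(1-\frac{4d+5}{4r}\right),\ 2\Delta\left(1-\frac1q\right)\right\}.\] -/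

import Mathlib

/-- An `r`-partite graph is a graph `G` with a proper colouring `c : G.Coloring (Fin r)`; its parts
`V₁, …, V_r` are the colour classes `c.colorClass i`. An independent `t`-transversal is an
independent set of `t` vertices that lie in `t` different parts. -/
def IsIndepTransversal {V : Type*} {G : SimpleGraph V} {r : ℕ} (c : G.Coloring (Fin r))
    (t : ℕ) (T : Finset V) : Prop :=
  G.IsIndepSet (T : Set V) ∧ Set.InjOn c (T : Set V) ∧ T.card = t

/-- The set of all `n` for which there is a finite `r`-partite graph with at least `n` vertices in
each part, maximum degree exactly `Δ`, and no independent `(r - D + 1)`-transversal. -/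
def avoidingSizes (r D Δ : ℕ) : Set ℕ :=
  {n | ∃ (V : Type) (_ : Fintype V) (G : SimpleGraph V) (_ : DecidableRel G.Adj)
      (c : G.Coloring (Fin r)),
      (∀ i : Fin r, n ≤ (c.colorClass i).ncard) ∧ G.maxDegree = Δ ∧
      ¬ ∃ T : Finset V, IsIndepTransversal c (r + 1 - D) T}

/-- The extremal function `n(r, D, Δ)`: the largest element of `avoidingSizes r D Δ`
(`0` if there is none). -/
noncomputable def extremalSize (r D Δ : ℕ) : ℕ := sSup (avoidingSizes r D Δ)

/-- The bound `max {2Δ(1 - (4d+5)/(4r)), 2Δ(1 - 1/q)}`, for `r, q ≥ 1`. -/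
noncomputable def sizeBound (r d q Δ : ℕ) : ℝ :=
  max (2 * (Δ : ℝ) * (1 - (4 * (d : ℝ) + 5) / (4 * (r : ℝ))))
    (2 * (Δ : ℝ) * (1 - 1 / (q : ℝ)))

/-!
Suppose that every independent partial transversal misses at least `t = d + 1` parts. By the first
term of the bound, dominating `k` parts takes at least `2 (k - t)` vertices. Haxell's argument,
started from a transversal missing exactly `t` parts, then grows an induced matching whose edges
form a forest of `t` trees on the parts. Once it covers as many parts as possible, the matching
dominates all of them, and by the first term again each of its vertices has more than `Δ / 2`
private neighbours there.

A matching tree contains an independent transversal of all its parts but one, which can be chosen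
freely. Hence a vertex `v` in the parts of a tree that is not dominated by that tree has two
neighbours `x₁` and `x₂` in the other trees. Let `xᵢyᵢ` be their edges. If a private neighbour `z`
of `yᵢ` is not adjacent to `v`, replacing `xᵢyᵢ` by `yᵢz` leaves `v` with fewer neighbours in the
matching; so in an optimal forest `v` is adjacent to all private neighbours of `y₁` and `y₂`, of
which there are more than `Δ`.

So every tree dominates its own parts. A tree with the fewest parts has `m ≤ q` of them and
`2 (m - 1)` vertices, and the second term of the bound says that these are too few.
-/

open Finset Function

section Domination

variable {V : Type*} {G : SimpleGraph V}

/-- Total domination of a vertex: `v` has a neighbour in `D`. A vertex of `D` need not be dominated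
by `D`. -/
def Dominates (G : SimpleGraph V) (D : Finset V) (v : V) : Prop :=
  ∃ x ∈ D, G.Adj x v

/-- No edge runs between `S` and `T`. The sets may overlap, and `Nonadj G S S` says that `S` is
independent. -/
def Nonadj (G : SimpleGraph V) (S T : Finset V) : Prop :=
  ∀ v ∈ T, ¬ Dominates G S v

theorem Dominates.mono {S T : Finset V} {v : V} (h : Dominates G S v) (hST : S ⊆ T) :
    Dominates G T v :=
  let ⟨x, hx, hxv⟩ := h
  ⟨x, hST hx, hxv⟩

@[simp]
theorem not_dominates_empty (v : V) : ¬ Dominates G ∅ v := by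
  simp [Dominates]

@[simp]
theorem dominates_insert [DecidableEq V] {D : Finset V} {x v : V} :
    Dominates G (insert x D) v ↔ G.Adj x v ∨ Dominates G D v := by
  simp [Dominates]

@[simp]
theorem dominates_union [DecidableEq V] {S T : Finset V} {v : V} :
    Dominates G (S ∪ T) v ↔ Dominates G S v ∨ Dominates G T v := by
  simp [Dominates, or_and_right, exists_or]

theorem Nonadj.symm {S T : Finset V} (h : Nonadj G S T) : Nonadj G T S :=
  fun x hx ⟨y, hy, hyx⟩ => h y hy ⟨x, hx, hyx.symm⟩

theorem nonadj_comm {S T : Finset V} : Nonadj G S T ↔ Nonadj G T S :=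
  ⟨Nonadj.symm, Nonadj.symm⟩

theorem Nonadj.mono {S S' T T' : Finset V} (h : Nonadj G S T) (hS : S' ⊆ S) (hT : T' ⊆ T) :
    Nonadj G S' T' :=
  fun v hv hd => h v (hT hv) (hd.mono hS)

@[simp]
theorem nonadj_empty_left (T : Finset V) : Nonadj G ∅ T :=
  fun v _ => not_dominates_empty v

@[simp]
theorem nonadj_empty_right (S : Finset V) : Nonadj G S ∅ := by
  simp [Nonadj]

variable [DecidableEq V]

@[simp]
theorem nonadj_insert_right {S T : Finset V} {v : V} :
    Nonadj G S (insert v T) ↔ ¬ Dominates G S v ∧ Nonadj G S T := by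
  simp [Nonadj]

@[simp]
theorem nonadj_insert_left {S T : Finset V} {v : V} :
    Nonadj G (insert v S) T ↔ ¬ Dominates G T v ∧ Nonadj G S T := by
  rw [nonadj_comm, nonadj_insert_right, nonadj_comm]

@[simp]
theorem nonadj_union_right {S T T' : Finset V} :
    Nonadj G S (T ∪ T') ↔ Nonadj G S T ∧ Nonadj G S T' := by
  simp [Nonadj, or_imp, forall_and]

@[simp]
theorem nonadj_union_left {S S' T : Finset V} :
    Nonadj G (S ∪ S') T ↔ Nonadj G S T ∧ Nonadj G S' T := by
  rw [nonadj_comm, nonadj_union_right, nonadj_comm, nonadj_comm (S := T)]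

theorem nonadj_biUnion_right {A : Type*} {s : Finset A} {S : Finset V} {T : A → Finset V} :
    Nonadj G S (s.biUnion T) ↔ ∀ a ∈ s, Nonadj G S (T a) := by
  simp only [Nonadj, mem_biUnion]
  exact ⟨fun h a ha v hv => h v ⟨a, ha, hv⟩, fun h v ⟨a, ha, hv⟩ => h a ha v hv⟩

end Domination

section Transversals

variable {V ι : Type*} {G : SimpleGraph V} {c : V → ι}

/-- An independent transversal of the parts `P`, where the parts of the graph are the fibres
of `c`. -/
structure IsTransversalOn (G : SimpleGraph V) (c : V → ι) (P : Finset ι) (S : Finset V) :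
    Prop where
  bijOn : Set.BijOn c S P
  indep : Nonadj G S S

/-- An independent transversal of the parts `P` in the graph without the neighbours of `D`. -/
structure IsTransversalAvoiding (G : SimpleGraph V) (c : V → ι) (P : Finset ι) (D S : Finset V) :
    Prop extends IsTransversalOn G c P S where
  avoids : Nonadj G D S

theorem isTransversalOn_empty : IsTransversalOn G c ∅ ∅ :=
  ⟨by simp, by simp⟩

theorem isTransversalOn_singleton (v : V) : IsTransversalOn G c {c v} {v} :=
  ⟨by simp, by simp [Nonadj, Dominates]⟩

namespace IsTransversalOn

variable {P Q : Finset ι} {S T : Finset V}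

theorem color_mem (h : IsTransversalOn G c P S) {v : V} (hv : v ∈ S) : c v ∈ P :=
  h.bijOn.mapsTo hv

theorem card_eq (h : IsTransversalOn G c P S) : #S = #P :=
  card_nbij c (fun _ => h.color_mem) h.bijOn.injOn h.bijOn.surjOn

variable [DecidableEq ι]

theorem image_eq (h : IsTransversalOn G c P S) : S.image c = P := by
  exact_mod_cast h.bijOn.image_eq

theorem image_subset (h : IsTransversalOn G c P S) (hT : T ⊆ S) : T.image c ⊆ P :=
  h.image_eq ▸ image_subset_image hT

theorem of_subset (h : IsTransversalOn G c P S) (hT : T ⊆ S) :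
    IsTransversalOn G c (T.image c) T where
  bijOn := by
    rw [coe_image]
    exact (h.bijOn.injOn.mono (mod_cast hT)).bijOn_image
  indep := h.indep.mono hT hT

variable [DecidableEq V]

theorem sdiff (h : IsTransversalOn G c P S) (hT : T ⊆ S) :
    IsTransversalOn G c (P \ T.image c) (S \ T) := by
  have himage : (S \ T).image c = P \ T.image c := by
    rw [image_sdiff_of_injOn h.bijOn.injOn hT, h.image_eq]
  exact himage ▸ h.of_subset sdiff_subset

theorem union (hS : IsTransversalOn G c P S) (hT : IsTransversalOn G c Q T) (hPQ : Disjoint P Q)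
    (hST : Nonadj G S T) : IsTransversalOn G c (P ∪ Q) (S ∪ T) where
  bijOn := by
    push_cast
    refine hS.bijOn.union hT.bijOn ?_
    rintro x (hx | hx) y (hy | hy) hxy
    · exact hS.bijOn.injOn hx hy hxy
    · exact (disjoint_left.1 hPQ (hS.color_mem hx) (hxy ▸ hT.color_mem hy)).elim
    · exact (disjoint_left.1 hPQ (hS.color_mem hy) (hxy ▸ hT.color_mem hx)).elim
    · exact hT.bijOn.injOn hx hy hxy
  indep := by simp [hS.indep, hT.indep, hST, hST.symm]

theorem insert (h : IsTransversalOn G c P S) {v : V} (hv : c v ∉ P) (hS : ¬ Dominates G S v) :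
    IsTransversalOn G c (insert (c v) P) (insert v S) :=
  (isTransversalOn_singleton v).union h (disjoint_singleton_left.2 hv)
    (nonadj_comm.1 (by simpa [Nonadj] using hS))

theorem insert_of_erase {v : V} (hv : c v ∈ P) (h : IsTransversalOn G c (P.erase (c v)) S)
    (hS : ¬ Dominates G S v) : IsTransversalOn G c P (Insert.insert v S) := by
  simpa [insert_erase hv] using h.insert (by simp) hS

omit [DecidableEq ι] in
theorem insert_erase (h : IsTransversalOn G c P S) {v w : V} (hv : v ∈ S) (hw : c w = c v)
    (hS : ¬ Dominates G S w) : IsTransversalOn G c P (Insert.insert w (S.erase v)) := by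
  classical
  refine insert_of_erase (hw ▸ h.color_mem hv) ?_ fun hd => hS (hd.mono (erase_subset _ _))
  simpa [hw, sdiff_singleton_eq_erase] using h.sdiff (singleton_subset_iff.2 hv)

theorem biUnion {A : Type*} {s : Finset A} {P : A → Finset ι} {S : A → Finset V}
    (h : ∀ a ∈ s, IsTransversalOn G c (P a) (S a)) (hP : (s : Set A).PairwiseDisjoint P)
    (hS : (s : Set A).Pairwise (Nonadj G on S)) :
    IsTransversalOn G c (s.biUnion P) (s.biUnion S) := by
  classical
  induction s using Finset.induction_on with
  | empty => simpa using isTransversalOn_empty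
  | insert a s ha ih =>
    rw [coe_insert, Set.pairwiseDisjoint_insert_of_notMem (mod_cast ha)] at hP
    rw [coe_insert, Set.pairwise_insert_of_notMem (mod_cast ha)] at hS
    rw [biUnion_insert, biUnion_insert]
    exact (h a (mem_insert_self a s)).union
      (ih (fun b hb => h b (mem_insert_of_mem hb)) hP.1 hS.1)
      ((disjoint_biUnion_right _ _ _).2 hP.2)
      (nonadj_biUnion_right.2 fun b hb => (hS.2 b hb).1)

end IsTransversalOn

end Transversals

section Haxell

variable {V ι : Type*} {G : SimpleGraph V} {c : V → ι}

/-- The parts `K` are totally dominated by `D`. -/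
def DominatesParts (G : SimpleGraph V) (c : V → ι) (D : Finset V) (K : Finset ι) : Prop :=
  ∀ v, c v ∈ K → Dominates G D v

/-- The obstruction that Haxell's argument turns into a dominating set: no vertex in the parts `J`
that is not dominated by `D` can be completed by an independent transversal of the parts `Q`
avoiding the neighbours of that vertex and of `D`. -/
def Blocked [DecidableEq V] (G : SimpleGraph V) (c : V → ι) (J : Finset ι) (D : Finset V)
    (Q : Finset ι) : Prop :=
  ∀ u Y, c u ∈ J → ¬ Dominates G D u → ¬ IsTransversalAvoiding G c Q (insert u D) Y

/-- The neighbours of `u` in `Y`. -/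
def nbrsIn (G : SimpleGraph V) [DecidableRel G.Adj] (u : V) (Y : Finset V) : Finset V :=
  {y ∈ Y | G.Adj u y}

section NbrsIn

variable [DecidableRel G.Adj] {u y : V} {Y : Finset V}

@[simp]
theorem mem_nbrsIn : y ∈ nbrsIn G u Y ↔ y ∈ Y ∧ G.Adj u y :=
  mem_filter

theorem nbrsIn_subset : nbrsIn G u Y ⊆ Y :=
  filter_subset _ _

end NbrsIn

variable [DecidableEq V] {J Q : Finset ι} {D Y : Finset V} {u : V}

theorem Blocked.nbrsIn_nonempty [DecidableRel G.Adj] (hB : Blocked G c J D Q) (huJ : c u ∈ J)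
    (huD : ¬ Dominates G D u) (hY : IsTransversalAvoiding G c Q D Y) : (nbrsIn G u Y).Nonempty := by
  by_contra! hempty
  have huY : ¬ Dominates G Y u := fun ⟨y, hy, hyu⟩ => by
    have : y ∈ nbrsIn G u Y := mem_nbrsIn.2 ⟨hy, hyu.symm⟩
    simp [hempty] at this
  exact hB u Y huJ huD ⟨hY.toIsTransversalOn, nonadj_insert_left.2 ⟨huY, hY.avoids⟩⟩

variable [DecidableEq ι]

theorem IsTransversalAvoiding.sdiff_nbrsIn [DecidableRel G.Adj]
    (hY : IsTransversalAvoiding G c Q D Y) (u : V) :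
    IsTransversalAvoiding G c (Q \ (nbrsIn G u Y).image c) (insert u (D ∪ nbrsIn G u Y))
      (Y \ nbrsIn G u Y) where
  toIsTransversalOn := hY.sdiff nbrsIn_subset
  avoids := by
    rw [nonadj_insert_left, nonadj_union_left]
    refine ⟨?_, hY.avoids.mono subset_rfl sdiff_subset, hY.indep.mono nbrsIn_subset sdiff_subset⟩
    rintro ⟨y, hy, hyu⟩
    obtain ⟨hyY, hyE⟩ := mem_sdiff.1 hy
    exact hyE (mem_nbrsIn.2 ⟨hyY, hyu.symm⟩)

/-- Exchanging one neighbour of `u` in `Y` for an undominated vertex `w` of the same part would give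
a transversal with fewer neighbours of `u`. -/
theorem Blocked.insert_nbrsIn [DecidableRel G.Adj] (hB : Blocked G c J D Q)
    (hY : MinimalFor (IsTransversalAvoiding G c Q D) (fun Y => #(nbrsIn G u Y)) Y) :
    Blocked G c (J ∪ (nbrsIn G u Y).image c) (insert u (D ∪ nbrsIn G u Y))
      (Q \ (nbrsIn G u Y).image c) := by
  set E := nbrsIn G u Y
  have hEY : E ⊆ Y := nbrsIn_subset
  have hE := hY.prop.of_subset hEY
  have hQ : Q \ E.image c ∪ E.image c = Q := sdiff_union_of_subset (hY.prop.image_subset hEY)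
  have hDE : Nonadj G D E := hY.prop.avoids.mono subset_rfl hEY
  intro w Z hw hwD hZ
  have hZavoids := hZ.avoids
  simp only [dominates_insert, dominates_union, not_or] at hwD
  simp only [nonadj_insert_left, nonadj_union_left] at hZavoids
  obtain ⟨huw, hDw, hEw⟩ := hwD
  obtain ⟨hZw, hZu, hDZ, hEZ⟩ := hZavoids
  rcases mem_union.1 hw with hwJ | hwE
  · have hZE := hZ.union hE sdiff_disjoint hEZ.symm
    rw [hQ] at hZE
    exact hB w _ hwJ hDw ⟨hZE, by simp [hZw, hEw, hDZ, hDE]⟩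
  · obtain ⟨e, he, hew⟩ := mem_image.1 hwE
    have hswap := hE.insert_erase he hew.symm hEw
    have hZE := hZ.union hswap sdiff_disjoint
      (nonadj_insert_right.2 ⟨hZw, hEZ.symm.mono subset_rfl (erase_subset _ _)⟩)
    rw [hQ] at hZE
    have hle : #E ≤ #(nbrsIn G u (Z ∪ insert w (E.erase e))) := hY.le
      ⟨hZE, by simp [hDZ, hDw, hDE.mono subset_rfl (erase_subset _ _)]⟩
    have hsub : nbrsIn G u (Z ∪ insert w (E.erase e)) ⊆ E.erase e := by
      intro x hx
      obtain ⟨hx, hux⟩ := mem_nbrsIn.1 hx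
      rcases mem_union.1 hx with hxZ | hx
      · exact (hZu ⟨x, hxZ, hux.symm⟩).elim
      · exact mem_of_mem_insert_of_ne hx (by rintro rfl; exact huw hux)
    exact (hle.trans (card_le_card hsub)).not_gt (card_erase_lt_of_mem he)

/-- Haxell's argument: as long as some vertex `u` of `J` is not dominated, add `u` and its
neighbours in a transversal meeting the fewest of them; this at least pays for the parts of those
neighbours, which join `J`. -/
theorem Blocked.exists_dominatesParts (hB : Blocked G c J D Q)
    (hY : ∃ Y, IsTransversalAvoiding G c Q D Y) :
    ∃ S ⊆ Q, ∃ D' : Finset V, #D' ≤ 2 * #S ∧ DominatesParts G c (D ∪ D') (J ∪ S) := by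
  classical
  induction hn : #Q using Nat.strong_induction_on generalizing J Q D with
  | _ n ih =>
  subst hn
  by_cases hdom : DominatesParts G c D J
  · exact ⟨∅, by simp, ∅, by simp, by simpa using hdom⟩
  obtain ⟨u, huJ, huD⟩ : ∃ u, c u ∈ J ∧ ¬ Dominates G D u := by
    simpa [DominatesParts] using hdom
  obtain ⟨Y, hYmin⟩ := exists_minimalFor_of_wellFoundedLT _ (fun Y => #(nbrsIn G u Y)) hY
  have hY := hYmin.prop
  set E := nbrsIn G u Y with hE
  have hEQ : E.image c ⊆ Q := hY.image_subset nbrsIn_subset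
  have hEcard : #E = #(E.image c) := (hY.of_subset nbrsIn_subset).card_eq
  have hEpos : 0 < #E := (hB.nbrsIn_nonempty huJ huD hY).card_pos
  have hlt : #(Q \ E.image c) < #Q := by
    rw [card_sdiff_of_subset hEQ]
    have := card_le_card hEQ
    omega
  obtain ⟨S, hS, D', hD', hdom'⟩ := ih _ hlt (hB.insert_nbrsIn hYmin) ⟨_, hY.sdiff_nbrsIn u⟩ rfl
  refine ⟨E.image c ∪ S, union_subset hEQ (hS.trans sdiff_subset), insert u (E ∪ D'), ?_, ?_⟩
  · have hcard : #(E.image c ∪ S) = #(E.image c) + #S :=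
      card_union_of_disjoint (disjoint_of_subset_right hS disjoint_sdiff)
    have := card_insert_le u (E ∪ D')
    have := card_union_le E D'
    omega
  · convert hdom' using 1
    · ext; simp only [mem_union, mem_insert, hE]; tauto
    · rw [union_assoc]

omit [DecidableEq ι] in
theorem exists_isTransversalAvoiding_or_dominatesParts (R : Finset V) (Q : Finset ι) :
    (∃ Y, IsTransversalAvoiding G c Q R Y) ∨
      ∃ K ⊆ Q, ∃ D : Finset V, #D + 2 ≤ 2 * #K ∧ DominatesParts G c (R ∪ D) K := by
  classical
  induction Q using Finset.induction_on with
  | empty => exact Or.inl ⟨∅, isTransversalOn_empty, by simp⟩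
  | insert i Q hi ih =>
    rcases ih with hY | ⟨K, hK, h⟩
    · by_cases hB : Blocked G c {i} R Q
      · right
        obtain ⟨S, hS, D, hD, hdom⟩ := hB.exists_dominatesParts hY
        refine ⟨insert i S, insert_subset_insert i hS, D, ?_, hdom⟩
        rw [card_insert_of_notMem fun h => hi (hS h)]
        omega
      · left
        obtain ⟨u, Y, rfl, huR, hY⟩ : ∃ u Y, c u = i ∧ ¬ Dominates G R u ∧
            IsTransversalAvoiding G c Q (insert u R) Y := by
          simpa [Blocked, mem_singleton] using hB
        obtain ⟨huY, hRY⟩ := nonadj_insert_left.1 hY.avoids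
        exact ⟨insert u Y, hY.insert hi huY, nonadj_insert_right.2 ⟨huR, hRY⟩⟩
    · exact Or.inr ⟨K, hK.trans (subset_insert _ _), h⟩

/-- Dominating `k` parts takes at least `2 * (k - t)` vertices. -/
def DominationBound (G : SimpleGraph V) (c : V → ι) (t : ℕ) : Prop :=
  ∀ D K, DominatesParts G c D K → 2 * #K ≤ #D + 2 * t

omit [DecidableEq ι] in
theorem Blocked.two_mul_card_le (hB : Blocked G c J D Q)
    (hY : ∃ Y, IsTransversalAvoiding G c Q D Y) (hJQ : Disjoint J Q) {t : ℕ}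
    (hbd : DominationBound G c t) : 2 * #J ≤ #D + 2 * t := by
  classical
  obtain ⟨S, hS, D', hD', hdom⟩ := hB.exists_dominatesParts hY
  have hbound := hbd _ _ hdom
  rw [card_union_of_disjoint (disjoint_of_subset_right hS hJQ)] at hbound
  have := card_union_le D D'
  omega

end Haxell

section MatchingTrees

variable {V ι : Type*} [DecidableEq V] {G : SimpleGraph V} {c : V → ι}
  {B B₁ B₂ B₃ : Finset ι} {D D₁ D₂ D₃ : Finset V} {x y z w : V} {i : ι}

/-- The edge `xy` runs between two disjoint sets of parts `B₁` and `B₂`, carrying the vertices `D₁`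
and `D₂`, and there is no other edge between `{x, y}`, `D₁` and `D₂`. -/
structure IsJoiningEdge (G : SimpleGraph V) (c : V → ι) (B₁ B₂ : Finset ι) (D₁ D₂ : Finset V)
    (x y : V) : Prop where
  disjoint : Disjoint B₁ B₂
  left_mem : c x ∈ B₁
  right_mem : c y ∈ B₂
  adj : G.Adj x y
  left_not_dominated : ¬ Dominates G (D₁ ∪ D₂) x
  right_not_dominated : ¬ Dominates G (D₁ ∪ D₂) y
  nonadj : Nonadj G D₁ D₂

theorem IsJoiningEdge.symm (h : IsJoiningEdge G c B₁ B₂ D₁ D₂ x y) :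
    IsJoiningEdge G c B₂ B₁ D₂ D₁ y x :=
  ⟨h.disjoint.symm, h.right_mem, h.left_mem, h.adj.symm, union_comm D₁ D₂ ▸ h.right_not_dominated,
    union_comm D₁ D₂ ▸ h.left_not_dominated, h.nonadj.symm⟩

variable [DecidableEq ι]

/-- `D` is the vertex set of an induced matching whose edges, after contraction of each part to a
point, form a spanning tree on the parts `B`. -/
inductive IsMatchingTree (G : SimpleGraph V) (c : V → ι) : Finset ι → Finset V → Prop
  | single (i : ι) : IsMatchingTree G c {i} ∅
  | join {B₁ B₂ : Finset ι} {D₁ D₂ : Finset V} {x y : V} (h₁ : IsMatchingTree G c B₁ D₁)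
      (h₂ : IsMatchingTree G c B₂ D₂) (h : IsJoiningEdge G c B₁ B₂ D₁ D₂ x y) :
      IsMatchingTree G c (B₁ ∪ B₂) (insert x (insert y (D₁ ∪ D₂)))

/-- Removing the edge `xy` from the matching tree on `B` with vertices `D` leaves the two matching
trees on `B₁` and `B₂` with vertices `D₁` and `D₂`. -/
structure IsSplitting (G : SimpleGraph V) (c : V → ι) (B : Finset ι) (D : Finset V) (x y : V)
    (B₁ B₂ : Finset ι) (D₁ D₂ : Finset V) : Prop extends
    IsJoiningEdge G c B₁ B₂ D₁ D₂ x y where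
  tree_left : IsMatchingTree G c B₁ D₁
  tree_right : IsMatchingTree G c B₂ D₂
  parts_eq : B = B₁ ∪ B₂
  verts_eq : D = insert x (insert y (D₁ ∪ D₂))

theorem IsSplitting.symm (h : IsSplitting G c B D x y B₁ B₂ D₁ D₂) :
    IsSplitting G c B D y x B₂ B₁ D₂ D₁ :=
  ⟨h.toIsJoiningEdge.symm, h.tree_right, h.tree_left, union_comm B₁ B₂ ▸ h.parts_eq, by
    rw [h.verts_eq, insert_comm, union_comm]⟩

theorem IsMatchingTree.nonempty (h : IsMatchingTree G c B D) : B.Nonempty := by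
  induction h with
  | single i => exact singleton_nonempty i
  | join _ _ _ ih₁ => exact ih₁.mono subset_union_left

theorem IsMatchingTree.dominates (h : IsMatchingTree G c B D) (hx : x ∈ D) : Dominates G D x := by
  induction h with
  | single => simp at hx
  | join _ _ h ih₁ ih₂ =>
    simp only [mem_insert, mem_union] at hx
    simp only [dominates_insert, dominates_union]
    rcases hx with rfl | rfl | hx | hx
    · exact Or.inr (Or.inl h.adj.symm)
    · exact Or.inl h.adj
    · exact Or.inr (Or.inr (Or.inl (ih₁ hx)))
    · exact Or.inr (Or.inr (Or.inr (ih₂ hx)))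

theorem IsMatchingTree.card_add_two_le (h : IsMatchingTree G c B D) : #D + 2 ≤ 2 * #B := by
  induction h with
  | single => simp
  | @join B₁ B₂ D₁ D₂ x y _ _ h ih₁ ih₂ =>
    have := card_union_of_disjoint h.disjoint
    have := card_insert_le x (insert y (D₁ ∪ D₂))
    have := card_insert_le y (D₁ ∪ D₂)
    have := card_union_le D₁ D₂
    omega

theorem IsJoiningEdge.exists_isTransversalOn_erase (h : IsJoiningEdge G c B₁ B₂ D₁ D₂ x y)
    (h₁ : ∃ S ⊆ D₁, IsTransversalOn G c (B₁.erase i) S)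
    (h₂ : ∃ S ⊆ D₂, IsTransversalOn G c (B₂.erase (c y)) S) (hi : i ∈ B₁) :
    ∃ S ⊆ insert y (D₁ ∪ D₂), IsTransversalOn G c ((B₁ ∪ B₂).erase i) S := by
  obtain ⟨S₁, hS₁, hT₁⟩ := h₁
  obtain ⟨S₂, hS₂, hT₂⟩ := h₂
  have hy := h.right_not_dominated
  simp only [dominates_union, not_or] at hy
  have hyS₁ : ¬ Dominates G S₁ y := fun hd => hy.1 (hd.mono hS₁)
  have hyS₂ : ¬ Dominates G S₂ y := fun hd => hy.2 (hd.mono hS₂)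
  refine ⟨S₁ ∪ insert y S₂, ?_, ?_⟩
  · rw [union_insert]
    exact insert_subset_insert _ (union_subset_union hS₁ hS₂)
  · rw [erase_union_distrib, erase_eq_of_notMem (disjoint_left.1 h.disjoint hi)]
    exact hT₁.union (hT₂.insert_of_erase h.right_mem hyS₂)
      (disjoint_of_subset_left (erase_subset _ _) h.disjoint)
      (nonadj_insert_right.2 ⟨hyS₁, h.nonadj.mono hS₁ hS₂⟩)

theorem IsMatchingTree.exists_isTransversalOn_erase (h : IsMatchingTree G c B D) (hi : i ∈ B) :
    ∃ S ⊆ D, IsTransversalOn G c (B.erase i) S := by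
  induction h generalizing i with
  | single j =>
    obtain rfl := mem_singleton.1 hi
    exact ⟨∅, subset_rfl, by simpa using isTransversalOn_empty⟩
  | @join B₁ B₂ D₁ D₂ x y _ _ h ih₁ ih₂ =>
    rcases mem_union.1 hi with hi | hi
    · obtain ⟨S, hS, hT⟩ := h.exists_isTransversalOn_erase (ih₁ hi) (ih₂ h.right_mem) hi
      exact ⟨S, hS.trans (subset_insert _ _), hT⟩
    · obtain ⟨S, hS, hT⟩ := h.symm.exists_isTransversalOn_erase (ih₂ hi) (ih₁ h.left_mem) hi
      refine ⟨S, hS.trans ?_, union_comm B₁ B₂ ▸ hT⟩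
      rw [union_comm D₂ D₁]
      exact insert_subset_insert _ (subset_insert _ _)

namespace IsSplitting

theorem left_mem_verts (h : IsSplitting G c B D x y B₁ B₂ D₁ D₂) : x ∈ D :=
  h.verts_eq ▸ mem_insert_self _ _

theorem left_subset (h : IsSplitting G c B D x y B₁ B₂ D₁ D₂) : B₁ ⊆ B :=
  h.parts_eq ▸ subset_union_left

theorem left_notMem (h : IsSplitting G c B D x y B₁ B₂ D₁ D₂) : x ∉ D₁ ∪ D₂ := by
  intro hx
  apply h.left_not_dominated
  rcases mem_union.1 hx with hx | hx
  · exact (h.tree_left.dominates hx).mono subset_union_left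
  · exact (h.tree_right.dominates hx).mono subset_union_right

theorem erase_left (h : IsSplitting G c B D x y B₁ B₂ D₁ D₂) : D.erase x = insert y (D₁ ∪ D₂) := by
  rw [h.verts_eq, erase_insert]
  simp [h.adj.ne, mem_union.not.1 h.left_notMem]

theorem eq_of_adj (h : IsSplitting G c B D x y B₁ B₂ D₁ D₂) (hw : w ∈ D) (hwx : G.Adj w x) :
    w = y := by
  have hw' : w ∈ insert y (D₁ ∪ D₂) := h.erase_left ▸ mem_erase.2 ⟨hwx.ne, hw⟩
  refine (mem_insert.1 hw').resolve_right fun hw => h.left_not_dominated ⟨w, hw, hwx⟩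

theorem exists_isTransversalOn_erase (h : IsSplitting G c B D x y B₁ B₂ D₁ D₂) (hi : i ∈ B₁) :
    ∃ S ⊆ D.erase x, IsTransversalOn G c (B.erase i) S := by
  rw [h.erase_left, h.parts_eq]
  exact h.toIsJoiningEdge.exists_isTransversalOn_erase (h.tree_left.exists_isTransversalOn_erase hi)
    (h.tree_right.exists_isTransversalOn_erase h.right_mem) hi

theorem attach_left (hs : IsSplitting G c B D z w B₁ B₂ D₁ D₂) (h₃ : IsMatchingTree G c B₃ D₃)
    (h : IsJoiningEdge G c B B₃ D D₃ x y) (hx : c x ∈ B₁) :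
    IsSplitting G c (B ∪ B₃) (insert x (insert y (D ∪ D₃))) z w (B₁ ∪ B₃) B₂
      (insert x (insert y (D₁ ∪ D₃))) D₂ := by
  obtain ⟨⟨hdisj, hz, hw, hzw, hzD, hwD, hD⟩, h₁, h₂, rfl, rfl⟩ := hs
  obtain ⟨hdisj', -, hy, hxy, hxD, hyD, hD'⟩ := h
  simp only [dominates_union, dominates_insert, nonadj_insert_left, nonadj_union_left, not_or,
    disjoint_union_left] at hzD hwD hxD hyD hD' hdisj'
  obtain ⟨⟨hzx, hwx, hxD₁, hxD₂⟩, hxD₃⟩ := hxD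
  obtain ⟨⟨hzy, hwy, hyD₁, hyD₂⟩, hyD₃⟩ := hyD
  obtain ⟨hzD₃, hwD₃, hD₁₃, hD₂₃⟩ := hD'
  have hjoin : IsJoiningEdge G c B₁ B₃ D₁ D₃ x y :=
    ⟨hdisj'.1, hx, hy, hxy, by simp [*], by simp [*], hD₁₃⟩
  refine ⟨⟨?_, mem_union_left _ hz, hw, hzw, ?_, ?_, ?_⟩, .join h₁ h₃ hjoin, h₂, ?_, ?_⟩
  · exact disjoint_union_left.2 ⟨hdisj, hdisj'.2.symm⟩
  · simp [*, G.adj_comm _ z]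
  · simp [*, G.adj_comm _ w]
  · simp [*, hD₂₃.symm]
  · exact union_right_comm _ _ _
  · ext; simp only [mem_union, mem_insert]; tauto

theorem attach (hs : IsSplitting G c B D z w B₁ B₂ D₁ D₂) (h₃ : IsMatchingTree G c B₃ D₃)
    (h : IsJoiningEdge G c B B₃ D D₃ x y) :
    ∃ B₁ B₂ D₁ D₂,
      IsSplitting G c (B ∪ B₃) (insert x (insert y (D ∪ D₃))) z w B₁ B₂ D₁ D₂ := by
  have hx : c x ∈ B₁ ∪ B₂ := hs.parts_eq ▸ h.left_mem
  rcases mem_union.1 hx with hx | hx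
  · exact ⟨_, _, _, _, hs.attach_left h₃ h hx⟩
  · exact ⟨_, _, _, _, (hs.symm.attach_left h₃ h hx).symm⟩

end IsSplitting

theorem IsMatchingTree.exists_isSplitting (h : IsMatchingTree G c B D) (hz : z ∈ D) :
    ∃ w B₁ B₂ D₁ D₂, IsSplitting G c B D z w B₁ B₂ D₁ D₂ := by
  induction h with
  | single => simp at hz
  | @join B₁ B₂ D₁ D₂ x y h₁ h₂ h ih₁ ih₂ =>
    have hs : IsSplitting G c _ _ x y B₁ B₂ D₁ D₂ := ⟨h, h₁, h₂, rfl, rfl⟩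
    simp only [mem_insert, mem_union] at hz
    rcases hz with rfl | rfl | hz | hz
    · exact ⟨_, _, _, _, _, hs⟩
    · exact ⟨_, _, _, _, _, hs.symm⟩
    · obtain ⟨w, _, _, _, _, hw⟩ := ih₁ hz
      exact ⟨w, hw.attach h₂ h⟩
    · obtain ⟨w, _, _, _, _, hw⟩ := ih₂ hz
      rw [union_comm B₁, insert_comm, union_comm D₁]
      exact ⟨w, hw.attach h₁ h.symm⟩

end MatchingTrees

section Update

variable {A β : Type*} [DecidableEq A]

theorem pairwise_on_update {r : β → β → Prop} (hr : ∀ s t, r s t → r t s)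
    {f : A → β} (hf : Pairwise (r on f)) {b : A} {x : β} (hx : ∀ a ≠ b, r x (f a)) :
    Pairwise (r on update f b x) := by
  intro a a' haa'
  rcases eq_or_ne a b with rfl | ha
  · simpa [onFun, haa'.symm] using hx a' haa'.symm
  rcases eq_or_ne a' b with rfl | ha'
  · simpa [onFun, ha] using hr _ _ (hx a ha)
  · simpa [onFun, ha, ha'] using hf haa'

theorem biUnion_update_union [Fintype A] [DecidableEq β] (f : A → Finset β) (b : A)
    (s : Finset β) : univ.biUnion (update f b (f b ∪ s)) = univ.biUnion f ∪ s := by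
  ext j
  simp only [mem_biUnion, mem_univ, true_and, mem_union]
  constructor
  · rintro ⟨a, ha⟩
    rcases eq_or_ne a b with rfl | hab
    · simp only [update_self, mem_union] at ha
      exact ha.imp_left fun h => ⟨a, h⟩
    · rw [update_of_ne hab] at ha
      exact Or.inl ⟨a, ha⟩
  · rintro (⟨a, ha⟩ | hj)
    · rcases eq_or_ne a b with rfl | hab
      · exact ⟨a, by simp [ha]⟩
      · exact ⟨a, by simpa [hab] using ha⟩
    · exact ⟨b, by simp [hj]⟩

end Update

/-- Vertex-disjoint matching trees, indexed by `A`, on disjoint sets of parts, without edges between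
different trees: an induced matching whose edges form a forest on the parts that it meets. -/
structure MatchingForest {V ι : Type*} [DecidableEq V] [DecidableEq ι] (G : SimpleGraph V)
    (c : V → ι) (A : Type*) where
  parts : A → Finset ι
  verts : A → Finset V
  tree : ∀ a, IsMatchingTree G c (parts a) (verts a)
  disjoint : Pairwise (Disjoint on parts)
  nonadj : Pairwise (Nonadj G on verts)

/-- Every independent transversal of a set of parts leaves out at least `t` parts. -/
def EveryTransversalMisses {V ι : Type*} [Fintype ι] [DecidableEq ι] (G : SimpleGraph V)
    (c : V → ι) (t : ℕ) : Prop :=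
  ∀ P T, IsTransversalOn G c P T → t ≤ #Pᶜ

namespace MatchingForest

variable {V ι A : Type*} [DecidableEq V] [DecidableEq ι] {G : SimpleGraph V} {c : V → ι}
  {a b : A} {u v x y z : V} {B₁ B₂ : Finset ι} {D₁ D₂ : Finset V}

/-- The forest `F` with its tree `b` replaced by the matching tree `D` on `B`. -/
def update [DecidableEq A] (F : MatchingForest G c A) (b : A) {B : Finset ι} {D : Finset V}
    (h : IsMatchingTree G c B D) (hB : ∀ a ≠ b, Disjoint B (F.parts a))
    (hD : ∀ a ≠ b, Nonadj G D (F.verts a)) : MatchingForest G c A where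
  parts := Function.update F.parts b B
  verts := Function.update F.verts b D
  tree a := by
    rcases eq_or_ne a b with rfl | ha
    · simpa using h
    · simpa [ha] using F.tree a
  disjoint := pairwise_on_update (fun _ _ h => h.symm) F.disjoint hB
  nonadj := pairwise_on_update (fun _ _ h => h.symm) F.nonadj hD

theorem verts_disjoint (F : MatchingForest G c A) (hab : a ≠ b) :
    Disjoint (F.verts a) (F.verts b) :=
  disjoint_left.2 fun _ hxa hxb => F.nonadj hab _ hxb ((F.tree a).dominates hxa)

theorem exists_isTransversalOn_erase_of_notMem_right (F : MatchingForest G c A) {i : ι}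
    (hs : IsSplitting G c (F.parts b) (F.verts b) x y B₁ B₂ D₁ D₂) (hi : i ∈ F.parts a)
    (hiB₂ : i ∉ B₂) : ∃ S ⊆ (F.verts a).erase x, IsTransversalOn G c ((F.parts a).erase i) S := by
  rcases eq_or_ne a b with rfl | hab
  · rw [hs.parts_eq, mem_union] at hi
    exact hs.exists_isTransversalOn_erase (hi.resolve_right hiB₂)
  · rw [erase_eq_of_notMem (disjoint_right.1 (F.verts_disjoint hab) hs.left_mem_verts)]
    exact (F.tree a).exists_isTransversalOn_erase hi

theorem exists_mem_parts_notMem_right (F : MatchingForest G c A)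
    (hs : IsSplitting G c (F.parts b) (F.verts b) x y B₁ B₂ D₁ D₂) (a : A) :
    ∃ i ∈ F.parts a, i ∉ B₂ := by
  rcases eq_or_ne a b with rfl | hab
  · exact ⟨c x, hs.left_subset hs.left_mem, disjoint_left.1 hs.disjoint hs.left_mem⟩
  · obtain ⟨i, hi⟩ := (F.tree a).nonempty
    exact ⟨i, hi, fun h => disjoint_left.1 (F.disjoint hab) hi (hs.symm.left_subset h)⟩

variable [Fintype A]

/-- The parts covered by the trees of a forest. -/
def allParts (F : MatchingForest G c A) : Finset ι :=
  univ.biUnion F.parts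

/-- The vertices of the matching of a forest. -/
def allVerts (F : MatchingForest G c A) : Finset V :=
  univ.biUnion F.verts

theorem mem_allParts {F : MatchingForest G c A} {i : ι} :
    i ∈ F.allParts ↔ ∃ a, i ∈ F.parts a := by
  simp [allParts]

theorem mem_allVerts {F : MatchingForest G c A} : v ∈ F.allVerts ↔ ∃ a, v ∈ F.verts a := by
  simp [allVerts]

theorem parts_subset (F : MatchingForest G c A) (a : A) : F.parts a ⊆ F.allParts :=
  subset_biUnion_of_mem _ (mem_univ a)

theorem verts_subset (F : MatchingForest G c A) (a : A) : F.verts a ⊆ F.allVerts :=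
  subset_biUnion_of_mem _ (mem_univ a)

theorem card_allParts (F : MatchingForest G c A) : #F.allParts = ∑ a, #(F.parts a) :=
  card_biUnion fun _ _ _ _ hab => F.disjoint hab

theorem card_allVerts_add_le (F : MatchingForest G c A) :
    #F.allVerts + 2 * Fintype.card A ≤ 2 * #F.allParts := by
  calc
    #F.allVerts + 2 * Fintype.card A ≤ (∑ a, #(F.verts a)) + ∑ _a : A, 2 := by
      rw [sum_const, card_univ, smul_eq_mul, mul_comm 2]
      gcongr
      exact card_biUnion_le
    _ = ∑ a, (#(F.verts a) + 2) := sum_add_distrib.symm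
    _ ≤ ∑ a, 2 * #(F.parts a) := sum_le_sum fun a _ => (F.tree a).card_add_two_le
    _ = 2 * #F.allParts := by rw [card_allParts, mul_sum]

theorem mem_verts_of_adj (F : MatchingForest G c A) (hx : x ∈ F.verts b) (hy : y ∈ F.allVerts)
    (hyx : G.Adj y x) : y ∈ F.verts b := by
  obtain ⟨a, ha⟩ := mem_allVerts.1 hy
  obtain rfl : a = b := by
    by_contra hab
    exact F.nonadj hab x hx ⟨y, ha, hyx⟩
  exact ha

theorem exists_isSplitting (F : MatchingForest G c A) (hx : x ∈ F.allVerts) :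
    ∃ b y B₁ B₂ D₁ D₂, IsSplitting G c (F.parts b) (F.verts b) x y B₁ B₂ D₁ D₂ := by
  obtain ⟨b, hb⟩ := mem_allVerts.1 hx
  exact ⟨b, (F.tree b).exists_isSplitting hb⟩

theorem eq_of_adj (F : MatchingForest G c A)
    (hs : IsSplitting G c (F.parts b) (F.verts b) x y B₁ B₂ D₁ D₂) (hz : z ∈ F.allVerts)
    (hzx : G.Adj z x) : z = y :=
  hs.eq_of_adj (F.mem_verts_of_adj hs.left_mem_verts hz hzx) hzx

theorem exists_attach (F : MatchingForest G c A) {e : V} (hu : c u ∈ F.allParts)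
    (he : c e ∉ F.allParts) (hue : G.Adj u e) (huD : ¬ Dominates G F.allVerts u)
    (heD : ¬ Dominates G F.allVerts e) :
    ∃ F' : MatchingForest G c A, F'.allParts = F.allParts ∪ {c e} ∧
      F'.allVerts = F.allVerts ∪ {u, e} := by
  classical
  obtain ⟨b, hb⟩ := mem_allParts.1 hu
  have hnot : ∀ a, c e ∉ F.parts a := fun a ha => he (F.parts_subset a ha)
  have hu' : ∀ a, ¬ Dominates G (F.verts a) u := fun a h => huD (h.mono (F.verts_subset a))
  have he' : ∀ a, ¬ Dominates G (F.verts a) e := fun a h => heD (h.mono (F.verts_subset a))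
  have hjoin : IsJoiningEdge G c (F.parts b) {c e} (F.verts b) ∅ u e :=
    ⟨disjoint_singleton_right.2 (hnot b), hb, mem_singleton_self _, hue, by simpa using hu' b,
      by simpa using he' b, nonadj_empty_right _⟩
  have hverts : insert u (insert e (F.verts b ∪ ∅)) = F.verts b ∪ {u, e} := by
    ext; simp only [mem_insert, mem_union, mem_singleton, notMem_empty]; tauto
  have htree : IsMatchingTree G c (F.parts b ∪ {c e}) (F.verts b ∪ {u, e}) :=
    hverts ▸ (F.tree b).join (.single (c e)) hjoin
  refine ⟨F.update b htree ?_ ?_,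
    biUnion_update_union _ _ _, biUnion_update_union _ _ _⟩
  · exact fun a ha => disjoint_union_left.2
      ⟨F.disjoint ha.symm, disjoint_singleton_left.2 (hnot a)⟩
  · intro a ha
    rw [nonadj_union_left, nonadj_insert_left, ← insert_empty, nonadj_insert_left]
    exact ⟨F.nonadj ha.symm, hu' a, he' a, nonadj_empty_left _⟩

/-- `z` is a private neighbour of `x`: a vertex in the parts of the forest whose only neighbour in
the matching is `x`. -/
structure IsPrivateNbr (F : MatchingForest G c A) (x z : V) : Prop where
  color_mem : c z ∈ F.allParts
  adj : G.Adj x z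
  eq_of_adj : ∀ w ∈ F.allVerts, G.Adj w z → w = x

open Classical in
/-- The finite set of private neighbours of `x`. -/
noncomputable def privateNbrs [Fintype V] (F : MatchingForest G c A) (x : V) : Finset V :=
  {z | F.IsPrivateNbr x z}

@[simp]
theorem mem_privateNbrs [Fintype V] {F : MatchingForest G c A} :
    z ∈ F.privateNbrs x ↔ F.IsPrivateNbr x z := by
  simp [privateNbrs]

/-- Replace the edge `xy` by `xz`. -/
theorem exists_switch (F : MatchingForest G c A)
    (hs : IsSplitting G c (F.parts b) (F.verts b) x y B₁ B₂ D₁ D₂) (hz : F.IsPrivateNbr x z)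
    (hzB₂ : c z ∈ B₂) :
    ∃ F' : MatchingForest G c A, F'.parts = F.parts ∧ (∀ a ≠ b, F'.verts a = F.verts a) ∧
      F'.allVerts ⊆ insert z (F.allVerts.erase y) := by
  classical
  obtain ⟨-, hxz, hzx⟩ := hz
  have hD : D₁ ∪ D₂ ⊆ F.verts b := by
    rw [hs.verts_eq]
    exact (subset_insert _ _).trans (subset_insert _ _)
  have hzD : ∀ D ⊆ F.allVerts, x ∉ D → ¬ Dominates G D z := fun D hD hxD ⟨w, hw, hwz⟩ =>
    hxD (hzx w (hD hw) hwz ▸ hw)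
  have hjoin : IsJoiningEdge G c B₁ B₂ D₁ D₂ x z :=
    { hs.toIsJoiningEdge with
      right_mem := hzB₂
      adj := hxz
      right_not_dominated := hzD _ (hD.trans (F.verts_subset b)) hs.left_notMem }
  have htree : IsMatchingTree G c (F.parts b) (insert z (insert x (D₁ ∪ D₂))) := by
    rw [hs.parts_eq, insert_comm]
    exact .join hs.tree_left hs.tree_right hjoin
  have hsub : insert x (D₁ ∪ D₂) ⊆ (F.verts b).erase y :=
    (hs.symm.erase_left.trans (by rw [union_comm])).ge
  refine ⟨F.update b htree (fun a ha => F.disjoint ha.symm) fun a ha => ?_, ?_, ?_, ?_⟩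
  · refine nonadj_insert_left.2 ⟨?_, (F.nonadj ha.symm).mono (hsub.trans (erase_subset _ _))
      subset_rfl⟩
    exact hzD _ (F.verts_subset a) (disjoint_right.1 (F.verts_disjoint ha) hs.left_mem_verts)
  · exact update_eq_self b F.parts
  · exact fun a ha => update_of_ne ha _ _
  · intro w hw
    obtain ⟨a, ha⟩ := mem_allVerts.1 hw
    rcases eq_or_ne a b with rfl | hab
    · simp only [update, update_self] at ha
      exact insert_subset_insert z (hsub.trans (erase_subset_erase y (F.verts_subset a))) ha
    · simp only [update, update_of_ne hab] at ha
      refine mem_insert_of_mem (mem_erase.2 ⟨?_, F.verts_subset a ha⟩)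
      rintro rfl
      exact disjoint_left.1 (F.verts_disjoint hab) ha hs.symm.left_mem_verts

variable [Fintype ι]

theorem exists_card_parts_le (F : MatchingForest G c A) {q : ℕ}
    (hq : Fintype.card ι < (q + 1) * Fintype.card A) : ∃ a, #(F.parts a) ≤ q := by
  by_contra! hlarge
  have hle : Fintype.card A * (q + 1) ≤ #F.allParts := by
    rw [card_allParts, ← card_univ, ← smul_eq_mul]
    exact card_nsmul_le_sum univ _ _ fun a _ => hlarge a
  have := F.allParts.card_le_univ
  linarith

/-- Some independent transversal of the remaining parts has no edge to the forest. -/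
def Extendable (F : MatchingForest G c A) : Prop :=
  ∃ Y, IsTransversalAvoiding G c F.allPartsᶜ F.allVerts Y

/-- Every tree on parts `B` contains an independent transversal of all but one part of `B`. If in
the tree meeting the part of `u` this is the part missed, then adding `u` fills that part. -/
theorem exists_isTransversalOn_of_color_mem (F : MatchingForest G c A) (hu : c u ∈ F.allParts)
    (hS : ∀ a, ∃ i, (c u ∈ F.parts a → i = c u) ∧
      ∃ S ⊆ F.verts a, IsTransversalOn G c ((F.parts a).erase i) S ∧ ¬ Dominates G S u)
    (hY : ∃ Y, IsTransversalAvoiding G c F.allPartsᶜ (insert u F.allVerts) Y) :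
    ∃ P T, IsTransversalOn G c P T ∧ #Pᶜ < Fintype.card A := by
  classical
  obtain ⟨Y, hY⟩ := hY
  choose i hiu S hS hT hSu using hS
  obtain ⟨a₀, ha₀⟩ := mem_allParts.1 hu
  have hSF : univ.biUnion S ⊆ F.allVerts := biUnion_mono fun a _ => hS a
  have htrees := IsTransversalOn.biUnion (fun a (_ : a ∈ univ) => hT a)
    (fun a _ b _ hab => (F.disjoint hab).mono (erase_subset _ _) (erase_subset _ _))
    (fun a _ b _ hab => (F.nonadj hab).mono (hS a) (hS b))
  have hu_notMem : c u ∉ univ.biUnion fun a => (F.parts a).erase (i a) := by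
    simp only [mem_biUnion, mem_univ, true_and, mem_erase, not_exists, not_and]
    exact fun a ha hua => ha (hiu a hua).symm
  have hu_not_dominated : ¬ Dominates G (univ.biUnion S) u := by
    rintro ⟨w, hw, hwu⟩
    obtain ⟨a, -, ha⟩ := mem_biUnion.1 hw
    exact hSu a ⟨w, ha, hwu⟩
  have hdisj : Disjoint (insert (c u) (univ.biUnion fun a => (F.parts a).erase (i a)))
      F.allPartsᶜ :=
    disjoint_compl_right.mono_left <| insert_subset hu <| biUnion_mono fun a _ => erase_subset _ _
  refine ⟨_, _, (htrees.insert hu_notMem hu_not_dominated).union hY.toIsTransversalOn hdisj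
    (hY.avoids.mono (insert_subset_insert u hSF) subset_rfl), ?_⟩
  have hmissed : (insert (c u) (univ.biUnion fun a => (F.parts a).erase (i a)) ∪ F.allPartsᶜ)ᶜ ⊆
      (univ.erase a₀).image i := by
    intro j hj
    simp only [mem_compl, mem_union, mem_insert, mem_biUnion, mem_univ, true_and, mem_erase,
      not_or, not_not, not_exists, not_and'] at hj
    obtain ⟨⟨hju, hj⟩, hjF⟩ := hj
    obtain ⟨a, ha⟩ := mem_allParts.1 hjF
    obtain rfl : j = i a := hj a ha
    exact mem_image_of_mem i (mem_erase.2 ⟨fun h => hju (h ▸ hiu a₀ ha₀), mem_univ a⟩)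
  calc
    _ ≤ #((univ : Finset A).erase a₀) := (card_le_card hmissed).trans card_image_le
    _ < Fintype.card A := card_erase_lt_of_mem (mem_univ a₀)

theorem blocked (F : MatchingForest G c A) (hmiss : EveryTransversalMisses G c (Fintype.card A)) :
    Blocked G c F.allParts F.allVerts F.allPartsᶜ := by
  intro u Y hu huD hY
  obtain ⟨P, T, hT, hlt⟩ := F.exists_isTransversalOn_of_color_mem hu (fun a => by
    obtain ⟨i, hi, hiu⟩ : ∃ i ∈ F.parts a, c u ∈ F.parts a → i = c u := by
      by_cases hua : c u ∈ F.parts a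
      · exact ⟨c u, hua, fun _ => rfl⟩
      · obtain ⟨i, hi⟩ := (F.tree a).nonempty
        exact ⟨i, hi, fun h => (hua h).elim⟩
    obtain ⟨S, hS, hT⟩ := (F.tree a).exists_isTransversalOn_erase hi
    exact ⟨i, hiu, S, hS, hT, fun h => huD (h.mono (hS.trans (F.verts_subset a)))⟩) ⟨Y, hY⟩
  exact (hmiss P T hT).not_gt hlt

omit [Fintype ι] in
theorem exists_allVerts_eq_empty (U : Finset ι) (hU : #U = Fintype.card A) :
    ∃ F : MatchingForest G c A, F.allParts = U ∧ F.allVerts = ∅ := by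
  classical
  let e : A ≃ U := Fintype.equivOfCardEq (by simp [hU])
  let F : MatchingForest G c A :=
    { parts := fun a => {(e a : ι)}
      verts := fun _ => ∅
      tree := fun a => .single _
      disjoint := fun a b hab => by simpa [onFun, Subtype.ext_iff.symm] using hab
      nonadj := fun _ _ _ => nonadj_empty_left _ }
  refine ⟨F, ?_, eq_empty_of_forall_notMem fun v hv => ?_⟩
  · ext i
    simp only [mem_allParts, F, mem_singleton]
    exact ⟨fun ⟨a, ha⟩ => ha ▸ (e a).2, fun hi => ⟨e.symm ⟨i, hi⟩, by simp⟩⟩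
  · simp [mem_allVerts, F] at hv

theorem exists_extendable (hmiss : EveryTransversalMisses G c (Fintype.card A))
    (hbd : DominationBound G c (Fintype.card A)) : ∃ F : MatchingForest G c A, F.Extendable := by
  obtain ⟨⟨P, T⟩, hmin⟩ := exists_minimalFor_of_wellFoundedLT
    (fun PT : Finset ι × Finset V => IsTransversalOn G c PT.1 PT.2) (fun PT => #PT.1ᶜ)
    ⟨(∅, ∅), isTransversalOn_empty⟩
  have hT : IsTransversalOn G c P T := hmin.prop
  have hblocked : Blocked G c Pᶜ ∅ P := by
    intro u Y hu _ hY
    have huY : ¬ Dominates G Y u := (nonadj_insert_left.1 hY.avoids).1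
    have hle : #Pᶜ ≤ #(insert (c u) P)ᶜ :=
      hmin.le (j := (insert (c u) P, insert u Y)) (hY.insert (mem_compl.1 hu) huY)
    rw [compl_insert] at hle
    exact hle.not_gt (card_erase_lt_of_mem hu)
  have hcard_le := hblocked.two_mul_card_le ⟨T, hT, nonadj_empty_left T⟩ disjoint_compl_left hbd
  have hcard_ge := hmiss P T hT
  rw [card_empty] at hcard_le
  obtain ⟨F, hparts, hverts⟩ := exists_allVerts_eq_empty (G := G) (c := c) (A := A) Pᶜ (by omega)
  refine ⟨F, T, ?_, ?_⟩
  · rwa [hparts, compl_compl]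
  · rw [hverts]
    exact nonadj_empty_left T

theorem card_nbrsIn_le_one [DecidableRel G.Adj] {F : MatchingForest G c A} {Y : Finset V}
    (hmiss : EveryTransversalMisses G c (Fintype.card A))
    (hbd : DominationBound G c (Fintype.card A))
    (hY : MinimalFor (IsTransversalAvoiding G c F.allPartsᶜ F.allVerts)
      (fun Y => #(nbrsIn G u Y)) Y) : #(nbrsIn G u Y) ≤ 1 := by
  set E := nbrsIn G u Y
  have hEcard : #E = #(E.image c) := (hY.prop.of_subset nbrsIn_subset).card_eq
  have hdisj : Disjoint F.allParts (E.image c) :=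
    disjoint_compl_right.mono_right (hY.prop.image_subset nbrsIn_subset)
  have hle : 2 * #(F.allParts ∪ E.image c) ≤
      #(insert u (F.allVerts ∪ E)) + 2 * Fintype.card A :=
    ((F.blocked hmiss).insert_nbrsIn hY).two_mul_card_le ⟨_, hY.prop.sdiff_nbrsIn u⟩
      (disjoint_union_left.2 ⟨disjoint_compl_right.mono_right sdiff_subset, disjoint_sdiff⟩) hbd
  rw [card_union_of_disjoint hdisj] at hle
  have := card_insert_le u (F.allVerts ∪ E)
  have := card_union_le F.allVerts E
  have := F.card_allVerts_add_le
  omega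

theorem Extendable.exists_larger {F : MatchingForest G c A} (hF : F.Extendable)
    (hmiss : EveryTransversalMisses G c (Fintype.card A))
    (hbd : DominationBound G c (Fintype.card A)) (hu : c u ∈ F.allParts)
    (huD : ¬ Dominates G F.allVerts u) :
    ∃ F' : MatchingForest G c A, F'.Extendable ∧ #F'.allPartsᶜ < #F.allPartsᶜ := by
  classical
  obtain ⟨Y, hmin⟩ := exists_minimalFor_of_wellFoundedLT _ (fun Y => #(nbrsIn G u Y)) hF
  have hY := hmin.prop
  obtain ⟨e, he⟩ : ∃ e, nbrsIn G u Y = {e} := card_eq_one.1 <|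
    (card_nbrsIn_le_one hmiss hbd hmin).antisymm
      ((F.blocked hmiss).nbrsIn_nonempty hu huD hY).card_pos
  obtain ⟨heY, hue⟩ : e ∈ Y ∧ G.Adj u e := mem_nbrsIn.1 (he ▸ mem_singleton_self e)
  have hce : c e ∈ F.allPartsᶜ := hY.color_mem heY
  obtain ⟨F', hparts, hverts⟩ := F.exists_attach hu (mem_compl.1 hce) hue huD (hY.avoids e heY)
  have hcompl : F'.allPartsᶜ = F.allPartsᶜ \ {c e} := by
    rw [hparts, compl_union, sdiff_eq_inter_compl]
  have hverts' : F'.allVerts = insert u (F.allVerts ∪ {e}) := by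
    rw [hverts, union_insert]
  refine ⟨F', ⟨Y \ {e}, ?_⟩, ?_⟩
  · simpa only [hcompl, hverts', he, image_singleton] using hY.sdiff_nbrsIn u
  · rw [hcompl, sdiff_singleton_eq_erase]
    exact card_erase_lt_of_mem hce

theorem exists_isTransversalAvoiding_insert (F : MatchingForest G c A)
    (hbd : DominationBound G c (Fintype.card A)) (hF : DominatesParts G c F.allVerts F.allParts)
    (v : V) : ∃ Y, IsTransversalAvoiding G c F.allPartsᶜ (insert v F.allVerts) Y := by
  refine (exists_isTransversalAvoiding_or_dominatesParts _ _).resolve_right ?_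
  rintro ⟨K, hK, D, hDK, hdom⟩
  have hdom' : DominatesParts G c (insert v F.allVerts ∪ D) (F.allParts ∪ K) := by
    intro w hw
    rcases mem_union.1 hw with hw | hw
    · exact (hF w hw).mono ((subset_insert _ _).trans subset_union_left)
    · exact hdom w hw
  have hbound := hbd _ _ hdom'
  rw [card_union_of_disjoint (disjoint_compl_right.mono_right hK)] at hbound
  have := card_union_le (insert v F.allVerts) D
  have := card_insert_le v F.allVerts
  have := F.card_allVerts_add_le
  omega

/-- A forest is saturated if it is extendable and covers as many parts as possible. -/
def IsSaturated (F : MatchingForest G c A) : Prop :=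
  MinimalFor Extendable (fun F : MatchingForest G c A => #F.allPartsᶜ) F

theorem exists_isSaturated (hmiss : EveryTransversalMisses G c (Fintype.card A))
    (hbd : DominationBound G c (Fintype.card A)) : ∃ F : MatchingForest G c A, F.IsSaturated :=
  exists_minimalFor_of_wellFoundedLT _ _ (exists_extendable hmiss hbd)

namespace IsSaturated

variable {F F' : MatchingForest G c A}

theorem of_parts_eq (hF : F.IsSaturated) (hF' : F'.Extendable) (h : F'.parts = F.parts) :
    F'.IsSaturated := by
  refine ⟨hF', fun F'' hF'' hle => ?_⟩
  have hparts : F'.allParts = F.allParts := by rw [allParts, allParts, h]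
  simpa only [hparts] using hF.2 hF'' (by simpa only [hparts] using hle)

theorem dominatesParts (hF : F.IsSaturated) (hmiss : EveryTransversalMisses G c (Fintype.card A))
    (hbd : DominationBound G c (Fintype.card A)) : DominatesParts G c F.allVerts F.allParts := by
  intro u hu
  by_contra huD
  obtain ⟨F', hF', hlt⟩ := hF.prop.exists_larger hmiss hbd hu huD
  exact (hF.le hF').not_gt hlt

end IsSaturated

/-- Otherwise, adding `z` to transversals of the trees that avoid `x` gives a set which fills the
tree meeting the part of `z` and misses one part of every other tree. -/
theorem color_mem_right_of_isPrivateNbr (F : MatchingForest G c A)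
    (hmiss : EveryTransversalMisses G c (Fintype.card A))
    (hbd : DominationBound G c (Fintype.card A)) (hF : DominatesParts G c F.allVerts F.allParts)
    (hs : IsSplitting G c (F.parts b) (F.verts b) x y B₁ B₂ D₁ D₂) (hz : F.IsPrivateNbr x z) :
    c z ∈ B₂ := by
  obtain ⟨hzF, -, hzx⟩ := hz
  by_contra hzB₂
  obtain ⟨P, T, hT, hlt⟩ := F.exists_isTransversalOn_of_color_mem hzF (fun a => by
    obtain ⟨i, hi, hiB₂, hiz⟩ : ∃ i ∈ F.parts a, i ∉ B₂ ∧ (c z ∈ F.parts a → i = c z) := by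
      by_cases hza : c z ∈ F.parts a
      · exact ⟨c z, hza, hzB₂, fun _ => rfl⟩
      · obtain ⟨i, hi, hiB₂⟩ := F.exists_mem_parts_notMem_right hs a
        exact ⟨i, hi, hiB₂, fun h => (hza h).elim⟩
    obtain ⟨S, hS, hT⟩ := F.exists_isTransversalOn_erase_of_notMem_right hs hi hiB₂
    refine ⟨i, hiz, S, hS.trans (erase_subset _ _), hT, ?_⟩
    rintro ⟨w, hwS, hwz⟩
    obtain ⟨hwx, hwa⟩ := mem_erase.1 (hS hwS)
    exact hwx (hzx w (F.verts_subset a hwa) hwz)) (F.exists_isTransversalAvoiding_insert hbd hF z)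
  exact (hmiss P T hT).not_gt hlt

namespace IsSaturated

variable {F : MatchingForest G c A}

/-- Among the saturated forests with the parts and the tree `a` of `F`, one with the fewest
neighbours of `v` works: otherwise replacing the edge `xy` by `yz` would remove the neighbour `x`
of `v`. -/
theorem exists_forall_isPrivateNbr_adj (hF : F.IsSaturated)
    (hmiss : EveryTransversalMisses G c (Fintype.card A))
    (hbd : DominationBound G c (Fintype.card A)) (hv : ¬ Dominates G (F.verts a) v) :
    ∃ F' : MatchingForest G c A, F'.IsSaturated ∧ F'.parts = F.parts ∧ F'.verts a = F.verts a ∧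
      ∀ {b x y B₁ B₂ D₁ D₂}, IsSplitting G c (F'.parts b) (F'.verts b) x y B₁ B₂ D₁ D₂ →
        G.Adj v x → ∀ z, F'.IsPrivateNbr y z → G.Adj v z := by
  classical
  obtain ⟨F', hmin⟩ := exists_minimalFor_of_wellFoundedLT
    (fun F' : MatchingForest G c A => F'.IsSaturated ∧ F'.parts = F.parts ∧
      F'.verts a = F.verts a) (fun F' => #(nbrsIn G v F'.allVerts)) ⟨F, hF, rfl, rfl⟩
  obtain ⟨hF', hparts, hverts⟩ := hmin.prop
  refine ⟨F', hF', hparts, hverts, fun {b x y B₁ B₂ D₁ D₂} hs hvx z hz => ?_⟩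
  by_contra hvz
  have hdom := hF'.dominatesParts hmiss hbd
  have hab : a ≠ b := by
    rintro rfl
    exact hv ⟨x, hverts ▸ hs.left_mem_verts, hvx.symm⟩
  obtain ⟨F'', hparts', hverts', hsub⟩ := F'.exists_switch hs.symm hz
    (F'.color_mem_right_of_isPrivateNbr hmiss hbd hdom hs.symm hz)
  have hext : F''.Extendable := by
    obtain ⟨Y, hY⟩ := F'.exists_isTransversalAvoiding_insert hbd hdom z
    refine ⟨Y, by simpa only [allParts, hparts'] using hY.toIsTransversalOn, ?_⟩
    exact hY.avoids.mono (hsub.trans (insert_subset_insert z (erase_subset _ _))) subset_rfl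
  have hle : #(nbrsIn G v F'.allVerts) ≤ #(nbrsIn G v F''.allVerts) :=
    hmin.le ⟨hF'.of_parts_eq hext hparts', hparts'.trans hparts, (hverts' a hab).trans hverts⟩
  have hfewer : nbrsIn G v F''.allVerts ⊆ (nbrsIn G v F'.allVerts).erase x := by
    intro w hw
    obtain ⟨hw, hvw⟩ := mem_nbrsIn.1 hw
    have hw' := mem_of_mem_insert_of_ne (hsub hw) (by rintro rfl; exact hvz hvw)
    exact mem_erase.2 ⟨ne_of_mem_erase hw', mem_nbrsIn.2 ⟨mem_of_mem_erase hw', hvw⟩⟩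
  have hxmem : x ∈ nbrsIn G v F'.allVerts :=
    mem_nbrsIn.2 ⟨F'.verts_subset b hs.left_mem_verts, hvx⟩
  exact (hle.trans (card_le_card hfewer)).not_gt (card_erase_lt_of_mem hxmem)

/-- If `x` were the only neighbour of `v`, then `v` would be a private neighbour of `x`, so its part
would belong to the tree of `x`. -/
theorem exists_adj_ne (hF : F.IsSaturated) (hmiss : EveryTransversalMisses G c (Fintype.card A))
    (hbd : DominationBound G c (Fintype.card A)) (hva : c v ∈ F.parts a)
    (hv : ¬ Dominates G (F.verts a) v) :
    ∃ x ∈ F.allVerts, ∃ x' ∈ F.allVerts, x ≠ x' ∧ G.Adj v x ∧ G.Adj v x' := by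
  have hdom := hF.dominatesParts hmiss hbd
  obtain ⟨x, hx, hxv⟩ := hdom v (F.parts_subset a hva)
  by_contra! hunique
  have hpriv : F.IsPrivateNbr x v :=
    ⟨F.parts_subset a hva, hxv, fun w hw hwv => by
      by_contra hwx
      exact hunique x hx w hw (Ne.symm hwx) hxv.symm hwv.symm⟩
  obtain ⟨b, y, B₁, B₂, D₁, D₂, hs⟩ := F.exists_isSplitting hx
  have hvb := hs.symm.left_subset (F.color_mem_right_of_isPrivateNbr hmiss hbd hdom hs hpriv)
  obtain rfl : a = b := by
    by_contra hab
    exact disjoint_left.1 (F.disjoint hab) hva hvb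
  exact hv ⟨x, hs.left_mem_verts, hxv⟩

end IsSaturated

end MatchingForest

section Degree

variable {V ι A : Type*} [Fintype V] {G : SimpleGraph V} [DecidableRel G.Adj] {c : V → ι}
  {Δ t : ℕ}

theorem card_le_mul_of_forall_dominates (hdeg : ∀ v, G.degree v ≤ Δ) {W D : Finset V}
    (h : ∀ v ∈ W, Dominates G D v) : #W ≤ #D * Δ := by
  classical
  calc
    #W ≤ #(D.biUnion fun x => G.neighborFinset x) := card_le_card fun v hv => by
      simpa [Dominates] using h v hv
    _ ≤ #D * Δ := card_biUnion_le_card_mul _ _ _ fun x _ => hdeg x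

variable [DecidableEq ι]

theorem dominationBound_of_degree_le (hdeg : ∀ v, G.degree v ≤ Δ)
    (hsize : ∀ K : Finset ι, K.Nonempty → 4 * Δ * #K < 2 * #{v | c v ∈ K} + Δ * (4 * t + 1)) :
    DominationBound G c t := by
  intro D K hdom
  rcases K.eq_empty_or_nonempty with rfl | hK
  · simp
  have hcard : #{v | c v ∈ K} ≤ #D * Δ :=
    card_le_mul_of_forall_dominates hdeg fun v hv => hdom v (mem_filter.1 hv).2
  have hlt : Δ * (4 * #K) < Δ * (2 * #D + 4 * t + 1) := by linarith [hsize K hK]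
  have := lt_of_mul_lt_mul_left hlt (Nat.zero_le Δ)
  omega

namespace MatchingForest

variable [DecidableEq V] [Fintype A] {F : MatchingForest G c A} {a : A} {v x : V}

theorem lt_two_mul_card_privateNbrs (hdeg : ∀ v, G.degree v ≤ Δ)
    (hsize : ∀ K : Finset ι, K.Nonempty →
      4 * Δ * #K < 2 * #{v | c v ∈ K} + Δ * (4 * Fintype.card A + 1))
    (hF : DominatesParts G c F.allVerts F.allParts) (hx : x ∈ F.allVerts) :
    Δ < 2 * #(F.privateNbrs x) := by
  set W : Finset V := {v | c v ∈ F.allParts}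
  have hne : F.allParts.Nonempty := by
    obtain ⟨a, -⟩ := mem_allVerts.1 hx
    exact (F.tree a).nonempty.mono (F.parts_subset a)
  have hothers : #(W \ F.privateNbrs x) ≤ #(F.allVerts.erase x) * Δ := by
    refine card_le_mul_of_forall_dominates hdeg fun v hv => ?_
    obtain ⟨hvW, hvx⟩ := mem_sdiff.1 hv
    have hvF : c v ∈ F.allParts := (mem_filter.1 hvW).2
    by_contra honly
    have honly' : ∀ w ∈ F.allVerts, G.Adj w v → w = x := fun w hw hwv => by
      by_contra hwx
      exact honly ⟨w, mem_erase.2 ⟨hwx, hw⟩, hwv⟩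
    obtain ⟨w, hw, hwv⟩ := hF v hvF
    exact hvx (mem_privateNbrs.2 ⟨hvF, honly' w hw hwv ▸ hwv, honly'⟩)
  have hW : #W ≤ #(F.allVerts.erase x) * Δ + #(F.privateNbrs x) :=
    card_le_card_sdiff_add_card.trans (Nat.add_le_add_right hothers _)
  have hverts : #(F.allVerts.erase x) + 1 + 2 * Fintype.card A ≤ 2 * #F.allParts :=
    card_erase_add_one hx ▸ F.card_allVerts_add_le
  nlinarith [hsize _ hne, Nat.mul_le_mul_right Δ hverts]

/-- Otherwise `v` has two neighbours in the matching, and their partners have disjoint sets of more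
than `Δ / 2` private neighbours each, which can all be assumed to be adjacent to `v`. -/
theorem IsSaturated.dominatesParts_tree [Fintype ι] (hF : F.IsSaturated)
    (hdeg : ∀ v, G.degree v ≤ Δ)
    (hsize : ∀ K : Finset ι, K.Nonempty →
      4 * Δ * #K < 2 * #{v | c v ∈ K} + Δ * (4 * Fintype.card A + 1))
    (hmiss : EveryTransversalMisses G c (Fintype.card A)) (a : A) :
    DominatesParts G c (F.verts a) (F.parts a) := by
  have hbd := dominationBound_of_degree_le hdeg hsize
  intro v hva
  by_contra hv
  obtain ⟨F', hF', hparts, hverts, hpriv⟩ := hF.exists_forall_isPrivateNbr_adj hmiss hbd hv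
  have hdom := hF'.dominatesParts hmiss hbd
  obtain ⟨x, hx, x', hx', hxx', hvx, hvx'⟩ :=
    hF'.exists_adj_ne hmiss hbd (hparts ▸ hva) (hverts ▸ hv)
  obtain ⟨b, y, _, _, _, _, hs⟩ := F'.exists_isSplitting hx
  obtain ⟨b', y', _, _, _, _, hs'⟩ := F'.exists_isSplitting hx'
  have hy : y ∈ F'.allVerts := F'.verts_subset b hs.symm.left_mem_verts
  have hy' : y' ∈ F'.allVerts := F'.verts_subset b' hs'.symm.left_mem_verts
  have hyy' : y ≠ y' := by
    rintro rfl
    exact hxx' (F'.eq_of_adj hs.symm hx' hs'.adj).symm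
  have hdisj : Disjoint (F'.privateNbrs y) (F'.privateNbrs y') := by
    refine disjoint_left.2 fun z hz hz' => hyy' ?_
    exact (mem_privateNbrs.1 hz').eq_of_adj y hy (mem_privateNbrs.1 hz).adj
  have hcard : #(F'.privateNbrs y) + #(F'.privateNbrs y') ≤ Δ := by
    rw [← card_union_of_disjoint hdisj]
    refine (card_le_card (union_subset ?_ ?_)).trans (hdeg v)
    · exact fun z hz => (G.mem_neighborFinset v z).2 (hpriv hs hvx z (mem_privateNbrs.1 hz))
    · exact fun z hz => (G.mem_neighborFinset v z).2 (hpriv hs' hvx' z (mem_privateNbrs.1 hz))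
  have := lt_two_mul_card_privateNbrs hdeg hsize hdom hy
  have := lt_two_mul_card_privateNbrs hdeg hsize hdom hy'
  omega

end MatchingForest

theorem exists_isTransversalOn_card_compl_lt [Fintype ι] {q : ℕ} (hdeg : ∀ v, G.degree v ≤ Δ)
    (hsize : ∀ K : Finset ι, K.Nonempty → 4 * Δ * #K < 2 * #{v | c v ∈ K} + Δ * (4 * t + 1))
    (hsmall : ∀ K : Finset ι, K.Nonempty → #K ≤ q → 2 * Δ * #K < #{v | c v ∈ K} + 2 * Δ)
    (hq : Fintype.card ι < (q + 1) * t) : ∃ P T, IsTransversalOn G c P T ∧ #Pᶜ < t := by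
  classical
  by_contra! hmiss
  rw [← Fintype.card_fin t] at hsize hq hmiss
  obtain ⟨F, hF⟩ := MatchingForest.exists_isSaturated hmiss
    (dominationBound_of_degree_le hdeg hsize)
  obtain ⟨a, ha⟩ := F.exists_card_parts_le hq
  have hdom := hF.dominatesParts_tree hdeg hsize hmiss a
  have hcard : #{v | c v ∈ F.parts a} ≤ #(F.verts a) * Δ :=
    card_le_mul_of_forall_dominates hdeg fun v hv => hdom v (mem_filter.1 hv).2
  nlinarith [hsmall _ (F.tree a).nonempty ha, Nat.mul_le_mul_right Δ (F.tree a).card_add_two_le]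

end Degree

section SizeBound

variable {r d q Δ : ℕ}

theorem sizeBound_nonneg (hq : 0 < q) : 0 ≤ sizeBound r d q Δ := by
  have : 1 / (q : ℝ) ≤ 1 := (div_le_one (mod_cast hq)).2 (mod_cast hq)
  exact le_max_of_le_right (mul_nonneg (by positivity) (by linarith))

variable {V ι : Type*} [Fintype V] [DecidableEq ι] {c : V → ι} {K : Finset ι}

theorem card_filter_mem_eq_sum (c : V → ι) (K : Finset ι) :
    #{v | c v ∈ K} = ∑ i ∈ K, (c ⁻¹' {i}).ncard := by
  rw [card_eq_sum_card_fiberwise (f := c) (t := K) (by intro v; simp)]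
  refine sum_congr rfl fun i hi => ?_
  rw [← Set.ncard_coe_finset]
  congr 1
  ext v
  simp only [coe_filter, mem_filter, mem_univ, true_and, Set.mem_ofPred_eq, Set.mem_preimage,
    Set.mem_singleton_iff]
  exact ⟨And.right, fun h => ⟨h ▸ hi, h⟩⟩

theorem card_mul_lt_card_filter_mem {s : ℝ} (hs : ∀ i, s < (c ⁻¹' {i}).ncard)
    (hK : K.Nonempty) : #K * s < #{v | c v ∈ K} := by
  rw [card_filter_mem_eq_sum, Nat.cast_sum, ← nsmul_eq_mul, ← sum_const]
  exact sum_lt_sum_of_nonempty hK fun i _ => hs i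

theorem lt_two_mul_card_filter_mem (hs : ∀ i, sizeBound r d q Δ < (c ⁻¹' {i}).ncard)
    (hK : K.Nonempty) (hKr : #K ≤ r) :
    4 * Δ * #K < 2 * #{v | c v ∈ K} + Δ * (4 * (d + 1) + 1) := by
  have hlt := card_mul_lt_card_filter_mem
    (fun i => (le_max_left _ _ : _ ≤ sizeBound r d q Δ).trans_lt (hs i)) hK
  have hr : (0 : ℝ) < r := mod_cast hK.card_pos.trans_le hKr
  have hfrac : #K * ((4 * d + 5) / (4 * r) : ℝ) ≤ (4 * d + 5) / 4 := by
    calc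
      #K * ((4 * d + 5) / (4 * r) : ℝ) ≤ r * ((4 * d + 5) / (4 * r)) := by gcongr
      _ = (4 * d + 5) / 4 := by field_simp
  have hreal : (4 * Δ * #K : ℝ) < 2 * #{v | c v ∈ K} + Δ * (4 * (d + 1) + 1) := by
    linarith [mul_le_mul_of_nonneg_left hfrac Δ.cast_nonneg]
  exact_mod_cast hreal

theorem lt_card_filter_mem_add (hs : ∀ i, sizeBound r d q Δ < (c ⁻¹' {i}).ncard)
    (hK : K.Nonempty) (hKq : #K ≤ q) : 2 * Δ * #K < #{v | c v ∈ K} + 2 * Δ := by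
  have hlt := card_mul_lt_card_filter_mem
    (fun i => (le_max_right _ _ : _ ≤ sizeBound r d q Δ).trans_lt (hs i)) hK
  have hq : (0 : ℝ) < q := mod_cast hK.card_pos.trans_le hKq
  have hfrac : (#K : ℝ) * (1 / q) ≤ 1 := by
    rw [mul_one_div, div_le_one hq]
    exact_mod_cast hKq
  have hreal : (2 * Δ * #K : ℝ) < #{v | c v ∈ K} + 2 * Δ := by
    linarith [mul_le_mul_of_nonneg_left hfrac Δ.cast_nonneg]
  exact_mod_cast hreal

end SizeBound

section IndepTransversal

variable {r d q k Δ : ℕ}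

theorem IsTransversalOn.isIndepSet {V ι : Type*} {G : SimpleGraph V} {c : V → ι} {P : Finset ι}
    {S : Finset V} (h : IsTransversalOn G c P S) : G.IsIndepSet (S : Set V) :=
  fun x hx y hy _ hxy => h.indep y hy ⟨x, hx, hxy⟩

theorem exists_isIndepTransversal {V : Type*} [Fintype V] {G : SimpleGraph V} [DecidableRel G.Adj]
    (hr : r = q * (d + 1) + k) (hk : k ≤ d) (c : G.Coloring (Fin r)) (hΔ : G.maxDegree ≤ Δ)
    (hsize : ∀ i : Fin r, sizeBound r d q Δ < ((c.colorClass i).ncard : ℝ)) :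
    ∃ T : Finset V, IsIndepTransversal c (r - d) T := by
  obtain ⟨P, S, hS, hP⟩ := exists_isTransversalOn_card_compl_lt (G := G) (c := c) (t := d + 1)
    (fun v => (G.degree_le_maxDegree v).trans hΔ)
    (fun K hK => lt_two_mul_card_filter_mem hsize hK (card_finset_fin_le K))
    (fun K => lt_card_filter_mem_add hsize)
    (by rw [Fintype.card_fin, add_mul]; omega)
  rw [card_compl, Fintype.card_fin, ← hS.card_eq] at hP
  obtain ⟨T, hT, hcard⟩ := exists_subset_card_eq (show r - d ≤ #S by omega)
  exact ⟨T, (hS.of_subset hT).isIndepSet, (hS.of_subset hT).bijOn.injOn, hcard⟩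

theorem le_sizeBound_of_mem_avoidingSizes (hr : r = q * (d + 1) + k) (hk : k ≤ d) {n : ℕ}
    (hn : n ∈ avoidingSizes r (d + 1) Δ) : (n : ℝ) ≤ sizeBound r d q Δ := by
  obtain ⟨V, _, G, _, c, hsize, hΔ, hT⟩ := hn
  by_contra! hlt
  rw [Nat.add_sub_add_right] at hT
  exact hT <| exists_isIndepTransversal hr hk c hΔ.le fun i =>
    hlt.trans_le (mod_cast hsize i)

end IndepTransversal

theorem theorem1p1 (r d q k Δ : ℕ) (hd : d < r) (hr : r = q * (d + 1) + k) (hk : k ≤ d) :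
    (∀ (V : Type*) [Fintype V] (G : SimpleGraph V) [DecidableRel G.Adj]
        (c : G.Coloring (Fin r)), G.maxDegree ≤ Δ →
        (∀ i : Fin r, sizeBound r d q Δ < ((c.colorClass i).ncard : ℝ)) →
        ∃ T : Finset V, IsIndepTransversal c (r - d) T) ∧
      BddAbove (avoidingSizes r (d + 1) Δ) ∧
      (extremalSize r (d + 1) Δ : ℝ) ≤ sizeBound r d q Δ := by
  have hle : ∀ n ∈ avoidingSizes r (d + 1) Δ, (n : ℝ) ≤ sizeBound r d q Δ := fun n =>
    le_sizeBound_of_mem_avoidingSizes hr hk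
  have hbdd : BddAbove (avoidingSizes r (d + 1) Δ) :=
    ⟨⌊sizeBound r d q Δ⌋₊, fun n hn => Nat.le_floor (hle n hn)⟩
  refine ⟨fun V _ G _ c hΔ hsize => exists_isIndepTransversal hr hk c hΔ hsize, hbdd, ?_⟩
  rcases (avoidingSizes r (d + 1) Δ).eq_empty_or_nonempty with hempty | hne
  · rw [extremalSize, hempty, csSup_empty, bot_eq_zero, Nat.cast_zero]
    refine sizeBound_nonneg (Nat.pos_of_ne_zero ?_)
    rintro rfl
    omega
  · exact hle _ (Nat.sSup_mem hne hbdd)
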